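/- **Setting.** Let $1\le m\le n-1$ and let $\Omega\subset\mathbb R^n$ be a bounded domain (nonempty, open, connected) of class $C^2$, with boundary $S=\partial\Omega$ and unit normal $\nu^S$ along $S$ pointing into $\Omega$. Let $G(m,n)$ be the Grassmannian of $m$-planes in $\mathbb R^n$, identified with the orthogonal projections $P\in\mathbb R^{n\times n}$ of rank $m$, and let $G_{m-1}(TS)=\{(x,Q): x\in S,\ Q\in G(m-1,n),\ Q\subset T_xS\}$. For $v\notin Q$, $v\wedge Q$ denotes the span of $v$ and $Q$. *Orthogonal slices.* For an affine $m$-plane $x_0+P$, a connected component $\Delta\neq\emptyset$ of the interior (relative to $x_0+P$) of $\overline\Omega\cap(x_0+P)$ is an orthogonal $m$-slice of $\Omega$ if $\nu^S(x)\in P$ for all $x\in\partial\Delta$ (boundary relative to $x_0+P$). *Varifolds.* $\mathbf{CV}^m_\perp(\Omega)$ is the class of $m$-varifolds $V$ in $\mathbb R^n$ (Radon measures on $\mathbb R^n\times G(m,n)$) with support in $\overline\Omega$ for which there are a curvature $B=B_V\in L^1(V)$, with values in the bilinear maps $\mathbb R^n\times\mathbb R^n\to\mathbb R^n$, and an associated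 boundary varifold $\Gamma$ (a Radon measure on $G_{m-1}(TS)$) such that for all $\phi\in C^1(\mathbb R^n\times\mathbb R^{n\times n},\mathbb R^n)$ $$\int\big(D_P\phi\cdot B+\langle \operatorname{tr}B,\phi\rangle+\langle D_x\phi,P\rangle\big)\,dV(x,P)=-\int_{G_{m-1}(TS)}\langle\nu^S(x),\phi(x,\nu^S(x)\wedge Q)\rangle\,d\Gamma(x,Q).$$ Here, for an orthonormal basis $(e_i)$ of $\mathbb R^n$, $D_P\phi\cdot B=\sum_i\langle D_P\phi(x,P)[B(e_i,\cdot)],e_i\rangle$, $\operatorname{tr}B=\sum_iB(e_i,e_i)$ and $\langle D_x\phi,P\rangle=\sum_i\langle D_x\phi(x,P)[Pe_i],e_i\rangle$. Let $\mathbf M$ denote the mass (total measure), $|B|^2=\sum_{i,j}|B(e_i,e_j)|^2$ and $\|B\|_{L^p(V)}^p=\int|B|^p\,dV\in[0,\infty]$. Put $$\varkappa^{m,p}(\Omega)=\inf\big\{\|B_V\|_{L^p(V)}^p:\ V\in\mathbf{CV}^m_\perp(\Omega),\ \mathbf M(V)=1\big\}\in[0,\infty],$$ the infimum being over all such $V$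 and all curvatures $B_V$ of $V$ as above. **Theorem (Varifold Bounds).** Suppose that $\Omega$ has no orthogonal $m$-slices, and let $p\in[1,\infty)$. Then $\varkappa^{m,p}(\Omega)>0$. Moreover there is a constant $C=C(n,m,p,\Omega)<\infty$ such that, for every $V\in\mathbf{CV}^m_\perp(\Omega)$ with curvature $B_V$ and associated boundary varifold $\Gamma$, $$\mathbf M(V)\le\frac1{\varkappa^{m,p}(\Omega)}\,\|B_V\|_{L^p(V)}^p\ \text{ if }\ \|B_V\|_{L^p(V)}<\infty,\qquad \mathbf M(\Gamma)\le C\,\|B_V\|_{L^p(V)}^p .$$ -/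

import Mathlib

set_option maxSynthPendingDepth 3

open MeasureTheory
open scoped NNReal ENNReal InnerProductSpace

noncomputable section

namespace OrthVarifold

/-- `ℝⁿ` with the Euclidean norm. -/
abbrev Euc (n : ℕ) := EuclideanSpace ℝ (Fin n)

/-- `ℝ^{n×n}`, viewed as the linear endomorphisms of `ℝⁿ`. -/
abbrev Mat (n : ℕ) := Euc n →L[ℝ] Euc n

/-- `ℝⁿ`-valued bilinear forms on `ℝⁿ × ℝⁿ`, in curried form: `B v w` is `B(v,w)`. -/
abbrev BilForm (n : ℕ) := Euc n →L[ℝ] Euc n →L[ℝ] Euc n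

/-- The standard orthonormal basis vector `e_i` of `ℝⁿ`. -/
abbrev stdVec {n : ℕ} (i : Fin n) : Euc n := EuclideanSpace.single i 1

/-- The Grassmannian `G(m,n)`: the orthogonal projections of `ℝⁿ` of rank `m`. The projection `P`
is identified with the `m`-plane `P.range`. -/
def Grassmannian (m n : ℕ) : Set (Mat n) :=
  {P | IsStarProjection P ∧ Module.finrank ℝ P.range = m}

/-! ### Domains of class `C²` and their interior unit normal -/

/-- `ρ` is a `C²` defining function of `Ω` on the open neighbourhood `U` of `x`, that is
`Ω ∩ U = {ρ > 0} ∩ U`, and it is regular at `x`. -/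
structure IsDefiningFunction {n : ℕ} (Ω : Set (Euc n)) (x : Euc n) (ρ : Euc n → ℝ)
    (U : Set (Euc n)) : Prop where
  isOpen : IsOpen U
  mem : x ∈ U
  contDiffOn : ContDiffOn ℝ 2 ρ U
  mem_iff : ∀ y ∈ U, y ∈ Ω ↔ 0 < ρ y
  gradient_ne_zero : gradient ρ x ≠ 0

/-- Bounded domains (nonempty connected open sets) of class `C²`. -/
structure IsBoundedC2Domain {n : ℕ} (Ω : Set (Euc n)) : Prop where
  isOpen : IsOpen Ω
  isConnected : IsConnected Ω
  isBounded : Bornology.IsBounded Ω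
  exists_definingFunction : ∀ x ∈ frontier Ω, ∃ ρ U, IsDefiningFunction Ω x ρ U

open Classical in
/-- The unit normal `ν^S(x)` of `S = ∂Ω` at `x`, interior to `Ω`: the normalized gradient of any
defining function of `Ω` at `x` (see `innerNormal_eq` for the independence of the choice), and the
junk value `0` at points without defining function. -/
def innerNormal {n : ℕ} (Ω : Set (Euc n)) (x : Euc n) : Euc n :=
  if h : ∃ ρ U, IsDefiningFunction Ω x ρ U then
    ‖gradient h.choose x‖⁻¹ • gradient h.choose x
  else 0

/-! ### Orthogonal slices -/

/-- The interior of `Ω̄ ∩ (x₀ + P)`, relative to the affine plane `A = x₀ + P`. -/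
def sliceInterior {n : ℕ} (Ω : Set (Euc n)) (A : AffineSubspace ℝ (Euc n)) : Set A :=
  interior {y : A | (y : Euc n) ∈ closure Ω}

/-- `Δ` is an orthogonal slice of `Ω` in the affine plane `x₀ + P`: a connected component of
`int (Ω̄ ∩ (x₀ + P))` such that `ν^S ∈ P` along its (relative) boundary. -/
def IsOrthogonalSlice {n : ℕ} (Ω : Set (Euc n)) (x₀ : Euc n) (P : Mat n)
    (Δ : Set (AffineSubspace.mk' x₀ P.range)) : Prop :=
  (∃ x ∈ sliceInterior Ω (AffineSubspace.mk' x₀ P.range),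
    Δ = connectedComponentIn (sliceInterior Ω (AffineSubspace.mk' x₀ P.range)) x) ∧
  ∀ y ∈ frontier Δ, innerNormal Ω (y : Euc n) ∈ P.range

/-- `Ω` has an orthogonal `m`-slice. -/
def HasOrthogonalSlice {n : ℕ} (m : ℕ) (Ω : Set (Euc n)) : Prop :=
  ∃ x₀ : Euc n, ∃ P ∈ Grassmannian m n, ∃ Δ, IsOrthogonalSlice Ω x₀ P Δ

/-! ### Curvature varifolds with orthogonal boundary -/

/-- `D_Pφ(x,P) · B = ∑ ∂φⁱ/∂P^k_j (x,P) B_{ij}^k = ∑ᵢ ⟨D_Pφ(x,P)[B(eᵢ,·)], eᵢ⟩`. -/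
def derivPlaneDot {n : ℕ} (φ : Euc n × Mat n → Euc n) (z : Euc n × Mat n) (B : BilForm n) : ℝ :=
  ∑ i, ⟪fderiv ℝ φ z (0, B (stdVec i)), stdVec i⟫_ℝ

/-- The trace `tr B = ∑ᵢ B(eᵢ,eᵢ)`. -/
def trB {n : ℕ} (B : BilForm n) : Euc n := ∑ i, B (stdVec i) (stdVec i)

/-- The Hilbert-Schmidt product `⟨D_xφ(x,P), P⟩ = ∑ᵢ ⟨D_xφ(x,P)[P eᵢ], eᵢ⟩`. -/
def derivPointDot {n : ℕ} (φ : Euc n × Mat n → Euc n) (z : Euc n × Mat n) : ℝ :=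
  ∑ i, ⟪fderiv ℝ φ z (z.2 (stdVec i), 0), stdVec i⟫_ℝ

/-- `v ∧ Q`: the (orthogonal projection onto the) span of the vector `v` and the plane `Q`. -/
def wedge {n : ℕ} (v : Euc n) (Q : Mat n) : Mat n :=
  ((ℝ ∙ v) ⊔ Q.range).starProjection

/-- The bundle `G_{m-1}(TS) = {(x,Q) : x ∈ S, Q ∈ G(m-1,n), Q ⊂ T_x S}` where `S = ∂Ω`, and
`T_x S` is the orthogonal complement of `ν^S(x)`. -/
def boundaryBundle {n : ℕ} (m : ℕ) (Ω : Set (Euc n)) : Set (Euc n × Mat n) :=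
  {z | z.1 ∈ frontier Ω ∧ z.2 ∈ Grassmannian (m - 1) n ∧ z.2.range ≤ (ℝ ∙ innerNormal Ω z.1)ᗮ}

/-- `V` is an `m`-varifold with support in `Ω̄` and curvature `B ∈ L¹(V)` which is orthogonal to
`S = ∂Ω` along the `(m-1)`-varifold `Γ` in `S`. So `V ∈ CV^m_⊥(Ω)`, with curvature `B` and
associated boundary varifold `Γ`. A varifold is a Radon measure on the bundle of planes. Here it is
a Borel measure on the ambient space `ℝⁿ × ℝ^{n×n}` that is concentrated on the bundle of planes
over the compact set `Ω̄`, respectively `S`, hence a finite measure. -/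
structure IsOrthogonalCurvatureVarifold {n : ℕ} (m : ℕ) (Ω : Set (Euc n))
    (V : Measure (Euc n × Mat n)) (B : Euc n × Mat n → BilForm n)
    (Γ : Measure (Euc n × Mat n)) : Prop where
  finite_V : IsFiniteMeasure V
  support_V : V (closure Ω ×ˢ Grassmannian m n)ᶜ = 0
  integrable_B : Integrable B V
  finite_Γ : IsFiniteMeasure Γ
  support_Γ : Γ (boundaryBundle m Ω)ᶜ = 0
  orthogonal : ∀ φ : Euc n × Mat n → Euc n, ContDiff ℝ 1 φ →
    ∫ z, (derivPlaneDot φ z (B z) + ⟪trB (B z), φ z⟫_ℝ + derivPointDot φ z) ∂V =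
      - ∫ z, ⟪innerNormal Ω z.1, φ (z.1, wedge (innerNormal Ω z.1) z.2)⟫_ℝ ∂Γ

/-- The mass of a varifold. -/
def mass {n : ℕ} (V : Measure (Euc n × Mat n)) : ℝ≥0∞ := V Set.univ

/-- The Hilbert-Schmidt norm `|B| = (∑ᵢⱼ |B(eᵢ,eⱼ)|²)^{1/2}`. -/
def hsNorm {n : ℕ} (B : BilForm n) : ℝ := Real.sqrt (∑ i, ∑ j, ‖B (stdVec i) (stdVec j)‖ ^ 2)

/-- The curvature energy `‖B‖_{L^p(V)}^p = ∫ |B|^p dV ∈ [0,∞]`. -/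
def curvatureEnergy {n : ℕ} (p : ℝ) (V : Measure (Euc n × Mat n))
    (B : Euc n × Mat n → BilForm n) : ℝ≥0∞ :=
  ∫⁻ z, ENNReal.ofReal (hsNorm (B z) ^ p) ∂V

/-- `ϰ^{m,p}(Ω) = inf {‖B_V‖_{L^p(V)}^p : V ∈ CV^m_⊥(Ω), M(V) = 1} ∈ [0,∞]`. -/
def kappa {n : ℕ} (m : ℕ) (p : ℝ) (Ω : Set (Euc n)) : ℝ≥0∞ :=
  sInf {E | ∃ V B Γ, IsOrthogonalCurvatureVarifold m Ω V B Γ ∧ mass V = 1 ∧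
    E = curvatureEnergy p V B}

/-! ### The interior normal does not depend on the choice of the defining function -/

theorem IsDefiningFunction.eventually {n : ℕ} {Ω : Set (Euc n)} {x : Euc n} {ρ : Euc n → ℝ}
    {U : Set (Euc n)} (h : IsDefiningFunction Ω x ρ U) (hρ : ρ x = 0) {v : Euc n}
    (hv : 0 < ⟪gradient ρ x, v⟫_ℝ) : ∀ᶠ t in nhdsWithin (0 : ℝ) (Set.Ioi 0),
      x + t • v ∈ Ω ∧ x + t • (-v) ∉ Ω := by
  have hU : U ∈ nhds x := h.isOpen.mem_nhds h.mem
  have hd : HasFDerivAt ρ (fderiv ℝ ρ x) x :=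
    ((h.contDiffOn.contDiffAt hU).differentiableAt (by norm_num)).hasFDerivAt
  have hg : ∀ w, fderiv ℝ ρ x w = ⟪gradient ρ x, w⟫_ℝ := fun w => by
    rw [gradient, InnerProductSpace.toDual_symm_apply]
  have key : ∀ w : Euc n, HasDerivAt (fun t : ℝ => ρ (x + t • w)) ⟪gradient ρ x, w⟫_ℝ 0 := by
    intro w
    have hl : HasDerivAt (fun t : ℝ => x + t • w) w 0 := by
      have h0 := ((hasDerivAt_id (0 : ℝ)).smul_const w).const_add x
      rwa [one_smul] at h0
    have hd' : HasFDerivAt ρ (fderiv ℝ ρ x) (x + (0 : ℝ) • w) := by rwa [zero_smul, add_zero]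
    rw [← hg w]
    exact hd'.comp_hasDerivAt (0 : ℝ) hl
  have hin : ∀ w : Euc n, ∀ᶠ t in nhdsWithin (0 : ℝ) (Set.Ioi 0), x + t • w ∈ U := by
    intro w
    have hc : Filter.Tendsto (fun t : ℝ => x + t • w) (nhds 0) (nhds x) := by
      have : Continuous (fun t : ℝ => x + t • w) := by fun_prop
      simpa using this.tendsto 0
    exact (hc.eventually hU).filter_mono nhdsWithin_le_nhds
  have hslope : ∀ w : Euc n, 0 < ⟪gradient ρ x, w⟫_ℝ →
      ∀ᶠ t in nhdsWithin (0 : ℝ) (Set.Ioi 0), 0 < ρ (x + t • w) := by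
    intro w hw
    have h1 := (hasDerivAt_iff_tendsto_slope.1 (key w)).mono_left
      (nhdsWithin_mono (0 : ℝ) (fun t (ht : t ∈ Set.Ioi (0 : ℝ)) => ne_of_gt ht))
    filter_upwards [h1.eventually (lt_mem_nhds hw), self_mem_nhdsWithin] with t ht ht0
    have ht0' : (0 : ℝ) < t := ht0
    simp only [slope_def_field, zero_smul, add_zero, hρ, sub_zero] at ht
    exact (div_pos_iff_of_pos_right ht0').1 ht
  have hslope' : ∀ᶠ t in nhdsWithin (0 : ℝ) (Set.Ioi 0), ρ (x + t • (-v)) < 0 := by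
    have hw : ⟪gradient ρ x, -v⟫_ℝ < 0 := by simpa using hv
    have h1 := (hasDerivAt_iff_tendsto_slope.1 (key (-v))).mono_left
      (nhdsWithin_mono (0 : ℝ) (fun t (ht : t ∈ Set.Ioi (0 : ℝ)) => ne_of_gt ht))
    filter_upwards [h1.eventually (gt_mem_nhds hw), self_mem_nhdsWithin] with t ht ht0
    have ht0' : (0 : ℝ) < t := ht0
    simp only [slope_def_field, zero_smul, add_zero, hρ, sub_zero] at ht
    by_contra hcon
    exact absurd ht (not_lt.2 (div_nonneg (not_lt.1 hcon) ht0'.le))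
  filter_upwards [hin v, hin (-v), hslope v hv, hslope'] with t h1 h2 h3 h4
  exact ⟨(h.mem_iff _ h1).2 h3, fun hmem => absurd ((h.mem_iff _ h2).1 hmem) (not_lt.2 h4.le)⟩

theorem IsDefiningFunction.eq_zero {n : ℕ} {Ω : Set (Euc n)} {x : Euc n} {ρ : Euc n → ℝ}
    {U : Set (Euc n)} (h : IsDefiningFunction Ω x ρ U) (hΩ : IsOpen Ω) (hx : x ∈ frontier Ω) :
    ρ x = 0 := by
  have hU : U ∈ nhds x := h.isOpen.mem_nhds h.mem
  have hx' : x ∉ Ω := fun hm => by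
    rw [frontier, hΩ.interior_eq] at hx
    exact hx.2 hm
  have h1 : ¬ 0 < ρ x := fun hp => hx' ((h.mem_iff x h.mem).2 hp)
  refine le_antisymm (not_lt.1 h1) (not_lt.1 fun hneg => ?_)
  have hc : ContinuousAt ρ x := h.contDiffOn.continuousOn.continuousAt hU
  have hev : ∀ᶠ y in nhds x, y ∉ Ω := by
    filter_upwards [hU, hc.eventually (gt_mem_nhds hneg)] with y hy hy' hm
    exact absurd ((h.mem_iff y hy).1 hm) (not_lt.2 hy'.le)
  obtain ⟨y, hy, hyΩ⟩ := ((mem_closure_iff_frequently.1 hx.1).and_eventually hev).exists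
  exact hyΩ hy

theorem innerNormal_eq {n : ℕ} {Ω : Set (Euc n)} (hΩ : IsOpen Ω) {x : Euc n}
    (hx : x ∈ frontier Ω) {ρ : Euc n → ℝ} {U : Set (Euc n)} (h : IsDefiningFunction Ω x ρ U) :
    innerNormal Ω x = ‖gradient ρ x‖⁻¹ • gradient ρ x := by
  have hex : ∃ ρ U, IsDefiningFunction Ω x ρ U := ⟨ρ, U, h⟩
  rw [innerNormal, dif_pos hex]
  obtain ⟨U', h'⟩ := hex.choose_spec
  generalize hex.choose = ρ' at h'
  set a := gradient ρ' x
  set b := gradient ρ x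
  have ha : 0 < ‖a‖ := norm_pos_iff.2 h'.gradient_ne_zero
  have hb : 0 < ‖b‖ := norm_pos_iff.2 h.gradient_ne_zero
  by_contra hne
  have hlt : ⟪a, b⟫_ℝ < ‖a‖ * ‖b‖ := by
    refine lt_of_le_of_ne (real_inner_le_norm a b) fun heq => hne ?_
    have h2 := inner_eq_norm_mul_iff_real.1 heq
    rw [inv_smul_eq_iff₀ ha.ne', smul_comm, eq_inv_smul_iff₀ hb.ne', h2]
  have hva : 0 < ⟪a, ‖b‖ • a - ‖a‖ • b⟫_ℝ := by
    rw [inner_sub_right, inner_smul_right, inner_smul_right, real_inner_self_eq_norm_sq]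
    nlinarith
  have hvb : 0 < ⟪b, -(‖b‖ • a - ‖a‖ • b)⟫_ℝ := by
    rw [inner_neg_right, inner_sub_right, inner_smul_right, inner_smul_right,
      real_inner_self_eq_norm_sq, real_inner_comm]
    nlinarith
  obtain ⟨t, h1, h2⟩ := ((h'.eventually (h'.eq_zero hΩ hx) hva).and
    (h.eventually (h.eq_zero hΩ hx) hvb)).exists
  exact h2.2 (by simpa using h1.1)

end OrthVarifold

end

/-!
# Bounds for curvature varifolds with orthogonal boundary

The positivity of `kappa` is proved by contradiction and compactness. If `kappa = 0`, there are
orthogonal varifolds `V_k` of mass one whose curvatures tend to zero in `L¹`. The planes over `Ω̄`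
form a compact set, so by Prokhorov's theorem the `V_k` have a weak limit `V`. For test fields
`φ(x, P)` with `⟨ν, φ⟩ = 0` wherever `P` is orthogonal to the boundary (`conormalSet`), the boundary
term in the first variation formula vanishes, so that no control on the boundary varifolds is
needed and the limit satisfies `∫ ⟨D_xφ, P⟩ dV = 0` (`IsFlatVarifold`).

The support of such a `V` contains an orthogonal slice:

* It is not contained in `conormalSet Ω`. Indeed, if `ρ` vanishes on `∂Ω` and `∇ρ` is there a
  positive multiple of `ν`, then `φ = ρ ∇ρ` is admissible and `⟨D_xφ, P⟩ = |∇ρ|² > 0` on that set.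
* Away from `conormalSet Ω` it contains with `(x, P)` also `(x + v, P)` for all small `v ∈ P`, since
  the field `f(x - t P v, P) v` shows that `∫ f(x - t P v, P) dV` does not depend on `t`
  (`IsFlatVarifold.exists_add_mem_support`). Working with the support in place of the measure makes
  a disintegration of `V` along affine planes unnecessary.
* Take `(x₀, P)` in the support, but not in `conormalSet Ω`, and let `Δ` be the component of `x₀` in
  the relative interior of `Ω̄ ∩ (x₀ + P)`. At a point `y` of `x₀ + P` with `ν(y) ∈ P`, moving along
  `-ν` leaves `Ω̄`, so `Δ` has no such points. Hence the support is open and closed in `Δ × {P}` and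
  contains it. A boundary point `y` of `Δ` with `ν(y) ∉ P` would have a neighbourhood in `x₀ + P`
  inside the support, thus inside `Ω̄`, which is impossible. So `Δ` is an orthogonal slice
  (`IsFlatVarifold.hasOrthogonalSlice`).

The bound for the mass of `V` follows from the definition of `kappa` by scaling. Testing with `∇ρ`
bounds the mass of the boundary varifold by the mass of `V` and the `L¹` norm of the curvature
(`exists_boundary_mass_le`), and both are controlled by the curvature energy.
-/

namespace OrthVarifold

open Filter Topology

/-! ### Planes and bilinear forms -/

theorem isCompact_grassmannian (m n : ℕ) : IsCompact (Grassmannian m n) := by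
  have hrank : ∀ P : Mat n, IsStarProjection P →
      LinearMap.trace ℝ (Euc n) (P : Euc n →ₗ[ℝ] Euc n) = (Module.finrank ℝ P.range : ℝ) := by
    intro P hP
    have h : IsIdempotentElem (P : Euc n →ₗ[ℝ] Euc n) :=
      congrArg ContinuousLinearMap.toLinearMap hP.isIdempotentElem
    exact (LinearMap.IsIdempotentElem.isProj_range _ h).trace
  -- For projections the rank is the trace, which is continuous.
  have heq : Grassmannian m n = {P : Mat n | P * P = P} ∩ {P : Mat n | star P = P} ∩
      {P : Mat n | LinearMap.trace ℝ (Euc n) (P : Euc n →ₗ[ℝ] Euc n) = m} := by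
    ext P
    constructor
    · rintro ⟨hP, hr⟩
      refine ⟨⟨hP.isIdempotentElem, hP.isSelfAdjoint⟩, ?_⟩
      simp only [Set.mem_ofPred_eq]
      rw [hrank P hP, hr]
    · rintro ⟨⟨h1, h2⟩, h3⟩
      have hP : IsStarProjection P := ⟨h1, h2⟩
      refine ⟨hP, ?_⟩
      have h4 : LinearMap.trace ℝ (Euc n) (P : Euc n →ₗ[ℝ] Euc n) = m := h3
      rw [hrank P hP] at h4
      exact_mod_cast h4
  refine Metric.isCompact_of_isClosed_isBounded ?_ ?_
  · rw [heq]
    refine ((isClosed_eq (by fun_prop) continuous_id).inter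
      (isClosed_eq continuous_star continuous_id)).inter (isClosed_eq ?_ continuous_const)
    exact LinearMap.continuous_of_finiteDimensional
      ((LinearMap.trace ℝ (Euc n)).comp (ContinuousLinearMap.coeLM ℝ))
  · exact (Metric.isBounded_closedBall (x := (0 : Mat n)) (r := 1)).subset fun P hP =>
      by simpa using IsStarProjection.norm_le P hP.1

theorem sum_inner_stdVec_smul {n : ℕ} (v : Euc n) : ∑ i, ⟪v, stdVec i⟫_ℝ • stdVec i = v := by
  have := (EuclideanSpace.basisFun (Fin n) ℝ).sum_repr' v
  simpa [real_inner_comm] using this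

theorem norm_stdVec {n : ℕ} (i : Fin n) : ‖(stdVec i : Euc n)‖ = 1 := by simp [stdVec]

theorem norm_apply_apply_le_hsNorm {n : ℕ} (B : BilForm n) (i j : Fin n) :
    ‖B (stdVec i) (stdVec j)‖ ≤ hsNorm B := by
  refine Real.le_sqrt_of_sq_le ?_
  calc ‖B (stdVec i) (stdVec j)‖ ^ 2 ≤ ∑ j, ‖B (stdVec i) (stdVec j)‖ ^ 2 :=
        Finset.single_le_sum (f := fun j => ‖B (stdVec i) (stdVec j)‖ ^ 2)
          (fun _ _ => by positivity) (Finset.mem_univ j)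
    _ ≤ _ := Finset.single_le_sum (f := fun i => ∑ j, ‖B (stdVec i) (stdVec j)‖ ^ 2)
          (fun _ _ => by positivity) (Finset.mem_univ i)

theorem hsNorm_nonneg {n : ℕ} (B : BilForm n) : 0 ≤ hsNorm B := Real.sqrt_nonneg _

theorem continuous_hsNorm {n : ℕ} : Continuous (hsNorm : BilForm n → ℝ) := by
  unfold hsNorm
  fun_prop

theorem hsNorm_le {n : ℕ} (B : BilForm n) : hsNorm B ≤ n * ‖B‖ := by
  refine Real.sqrt_le_iff.2 ⟨by positivity, ?_⟩
  have h : ∀ i j : Fin n, ‖B (stdVec i) (stdVec j)‖ ^ 2 ≤ ‖B‖ ^ 2 := fun i j => by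
    have := B.le_opNorm₂ (stdVec i) (stdVec j)
    simp only [norm_stdVec, mul_one] at this
    gcongr
  calc ∑ i, ∑ j, ‖B (stdVec i) (stdVec j)‖ ^ 2 ≤ ∑ _i : Fin n, ∑ _j : Fin n, ‖B‖ ^ 2 :=
        Finset.sum_le_sum fun i _ => Finset.sum_le_sum fun j _ => h i j
    _ = (n * ‖B‖) ^ 2 := by simp; ring

theorem norm_apply_stdVec_le {n : ℕ} (B : BilForm n) (i : Fin n) :
    ‖B (stdVec i)‖ ≤ n * hsNorm B := by
  refine ContinuousLinearMap.opNorm_le_bound _ (mul_nonneg n.cast_nonneg (hsNorm_nonneg B))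
    fun v => ?_
  have hv : B (stdVec i) v = ∑ j, ⟪v, stdVec j⟫_ℝ • B (stdVec i) (stdVec j) := by
    conv_lhs => rw [← sum_inner_stdVec_smul v]
    simp only [map_sum, map_smul]
  rw [hv]
  calc ‖∑ j, ⟪v, stdVec j⟫_ℝ • B (stdVec i) (stdVec j)‖
      ≤ ∑ j : Fin n, ‖⟪v, stdVec j⟫_ℝ • B (stdVec i) (stdVec j)‖ := norm_sum_le _ _
    _ ≤ ∑ _j : Fin n, ‖v‖ * hsNorm B := by
        refine Finset.sum_le_sum fun j _ => ?_
        rw [norm_smul]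
        have h1 := norm_inner_le_norm (𝕜 := ℝ) v (stdVec j)
        simp only [norm_stdVec, mul_one] at h1
        exact mul_le_mul h1 (norm_apply_apply_le_hsNorm B i j) (norm_nonneg _) (norm_nonneg _)
    _ = n * hsNorm B * ‖v‖ := by simp; ring

theorem norm_trB_le {n : ℕ} (B : BilForm n) : ‖trB B‖ ≤ n * hsNorm B := by
  calc ‖trB B‖ ≤ ∑ i : Fin n, ‖B (stdVec i) (stdVec i)‖ := norm_sum_le _ _
    _ ≤ ∑ _i : Fin n, hsNorm B := Finset.sum_le_sum fun i _ => norm_apply_apply_le_hsNorm B i i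
    _ = n * hsNorm B := by simp

theorem continuous_trB {n : ℕ} : Continuous (trB : BilForm n → Euc n) := by
  unfold trB
  fun_prop

theorem abs_derivPlaneDot_le {n : ℕ} (φ : Euc n × Mat n → Euc n) (z : Euc n × Mat n)
    (B : BilForm n) : |derivPlaneDot φ z B| ≤ n * (‖fderiv ℝ φ z‖ * (n * hsNorm B)) := by
  calc |derivPlaneDot φ z B|
      ≤ ∑ i : Fin n, |⟪fderiv ℝ φ z (0, B (stdVec i)), stdVec i⟫_ℝ| :=
        Finset.abs_sum_le_sum_abs _ _
    _ ≤ ∑ _i : Fin n, ‖fderiv ℝ φ z‖ * (n * hsNorm B) := by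
        refine Finset.sum_le_sum fun i _ => ?_
        have h1 := abs_real_inner_le_norm (fderiv ℝ φ z (0, B (stdVec i))) (stdVec i)
        simp only [norm_stdVec, mul_one] at h1
        refine h1.trans (((fderiv ℝ φ z).le_opNorm _).trans ?_)
        gcongr
        simpa using norm_apply_stdVec_le B i
    _ = _ := by simp

theorem continuous_derivPointDot {n : ℕ} {φ : Euc n × Mat n → Euc n} (hφ : ContDiff ℝ 1 φ) :
    Continuous (derivPointDot φ) := by
  have := hφ.continuous_fderiv (by norm_num)
  unfold derivPointDot
  fun_prop

theorem continuous_derivPlaneDot_add {n : ℕ} {φ : Euc n × Mat n → Euc n} (hφ : ContDiff ℝ 1 φ) :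
    Continuous fun w : (Euc n × Mat n) × BilForm n =>
      derivPlaneDot φ w.1 w.2 + ⟪trB w.2, φ w.1⟫_ℝ := by
  have h1 : Continuous fun w : (Euc n × Mat n) × BilForm n => fderiv ℝ φ w.1 :=
    (hφ.continuous_fderiv (by norm_num)).comp continuous_fst
  have h2 : ∀ i : Fin n, Continuous fun w : (Euc n × Mat n) × BilForm n =>
      ((0 : Euc n), w.2 (stdVec i)) := fun i =>
    continuous_const.prodMk (continuous_snd.clm_apply continuous_const)
  exact (continuous_finsetSum _ fun i _ => (h1.clm_apply (h2 i)).inner continuous_const).add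
    ((continuous_trB.comp continuous_snd).inner (hφ.continuous.comp continuous_fst))

/-- The divergence along `P` of `f · v` is the derivative of `f` in the direction `P v`. -/
theorem derivPointDot_smul_const {n : ℕ} {f : Euc n × Mat n → ℝ} {z : Euc n × Mat n}
    (hf : DifferentiableAt ℝ f z) (v : Euc n) :
    derivPointDot (fun z => f z • v) z = fderiv ℝ f z (z.2 v, 0) := by
  have h : fderiv ℝ (fun z => f z • v) z = (fderiv ℝ f z).smulRight v :=
    (hf.hasFDerivAt.smul_const v).fderiv
  have hv : (z.2 v, (0 : Mat n)) = ∑ i, ⟪v, stdVec i⟫_ℝ • (z.2 (stdVec i), (0 : Mat n)) := by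
    have h1 : z.2 v = ∑ i, ⟪v, stdVec i⟫_ℝ • z.2 (stdVec i) := by
      conv_lhs => rw [← sum_inner_stdVec_smul v]
      simp only [map_sum, map_smul]
    ext1
    · simp [Prod.fst_sum, h1]
    · simp only [Prod.snd_sum, Prod.smul_snd, smul_zero, Finset.sum_const_zero]
  rw [hv, map_sum, derivPointDot, h]
  refine Finset.sum_congr rfl fun i _ => ?_
  rw [map_smul, ContinuousLinearMap.smulRight_apply, real_inner_smul_left, smul_eq_mul, mul_comm]

/-! ### The first variation -/

variable {n m : ℕ} {Ω : Set (Euc n)} {V Γ : Measure (Euc n × Mat n)}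
  {B : Euc n × Mat n → BilForm n}

theorem ae_mem_of_support (h : V (closure Ω ×ˢ Grassmannian m n)ᶜ = 0) :
    ∀ᵐ z ∂V, z ∈ closure Ω ×ˢ Grassmannian m n := h

theorem isCompact_planeBundle (hΩ : Bornology.IsBounded Ω) :
    IsCompact (closure Ω ×ˢ Grassmannian m n) :=
  hΩ.isCompact_closure.prod (isCompact_grassmannian m n)

theorem integrable_of_continuous_of_support [IsFiniteMeasure V] {E : Type*} [NormedAddCommGroup E]
    (hΩ : Bornology.IsBounded Ω)
    (h : V (closure Ω ×ˢ Grassmannian m n)ᶜ = 0) {f : Euc n × Mat n → E} (hf : Continuous f) :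
    Integrable f V := by
  obtain ⟨C, hC⟩ := (isCompact_planeBundle (m := m) hΩ).exists_bound_of_continuousOn hf.continuousOn
  exact Integrable.of_bound hf.aestronglyMeasurable C ((ae_mem_of_support h).mono hC)

theorem IsOrthogonalCurvatureVarifold.integrable_hsNorm
    (h : IsOrthogonalCurvatureVarifold m Ω V B Γ) : Integrable (fun z => hsNorm (B z)) V := by
  refine (h.integrable_B.norm.const_mul (n : ℝ)).mono'
    (continuous_hsNorm.comp_aestronglyMeasurable h.integrable_B.1) (ae_of_all _ fun z => ?_)
  rw [Real.norm_of_nonneg (hsNorm_nonneg _)]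
  exact hsNorm_le _

theorem IsOrthogonalCurvatureVarifold.aestronglyMeasurable_curvatureTerm
    (h : IsOrthogonalCurvatureVarifold m Ω V B Γ) {φ : Euc n × Mat n → Euc n}
    (hφ : ContDiff ℝ 1 φ) :
    AEStronglyMeasurable (fun z => derivPlaneDot φ z (B z) + ⟪trB (B z), φ z⟫_ℝ) V := by
  have hid : AEStronglyMeasurable (fun z : Euc n × Mat n => z) V := aestronglyMeasurable_id
  have hB : AEStronglyMeasurable B V := h.integrable_B.1
  have hpair : AEStronglyMeasurable (fun z => (z, B z)) V := hid.prodMk hB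
  have hcomp := (continuous_derivPlaneDot_add hφ).comp_aestronglyMeasurable hpair
  exact hcomp

/-- The curvature terms of the first variation formula are controlled by the `L¹` norm of the
curvature. -/
theorem IsOrthogonalCurvatureVarifold.abs_firstVariation_le (hΩ : Bornology.IsBounded Ω)
    (h : IsOrthogonalCurvatureVarifold m Ω V B Γ) {φ : Euc n × Mat n → Euc n}
    (hφ : ContDiff ℝ 1 φ) {M : ℝ}
    (hM : ∀ z ∈ closure Ω ×ˢ Grassmannian m n, ‖fderiv ℝ φ z‖ ≤ M ∧ ‖φ z‖ ≤ M) :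
    |∫ z, derivPointDot φ z ∂V +
      ∫ z, ⟪innerNormal Ω z.1, φ (z.1, wedge (innerNormal Ω z.1) z.2)⟫_ℝ ∂Γ| ≤
      (n * n + n) * M * ∫ z, hsNorm (B z) ∂V := by
  have := h.finite_V
  have hint : Integrable (derivPointDot φ) V :=
    integrable_of_continuous_of_support hΩ h.support_V (continuous_derivPointDot hφ)
  have hbd : ∀ᵐ z ∂V, ‖derivPlaneDot φ z (B z) + ⟪trB (B z), φ z⟫_ℝ‖ ≤
      (n * n + n) * M * hsNorm (B z) := by
    filter_upwards [ae_mem_of_support h.support_V] with z hz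
    obtain ⟨h1, h2⟩ := hM z hz
    have h0 := hsNorm_nonneg (B z)
    have hM0 : 0 ≤ M := (norm_nonneg _).trans h2
    calc ‖derivPlaneDot φ z (B z) + ⟪trB (B z), φ z⟫_ℝ‖
        ≤ ‖derivPlaneDot φ z (B z)‖ + ‖⟪trB (B z), φ z⟫_ℝ‖ := norm_add_le _ _
      _ ≤ n * (M * (n * hsNorm (B z))) + (n * hsNorm (B z)) * M := by
          gcongr
          · exact (abs_derivPlaneDot_le φ z (B z)).trans (by gcongr)
          · exact (norm_inner_le_norm _ _).trans
              (mul_le_mul (norm_trB_le _) h2 (norm_nonneg _) (by positivity))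
      _ = _ := by ring
  have hmeas := h.aestronglyMeasurable_curvatureTerm hφ
  have hint' : Integrable (fun z => derivPlaneDot φ z (B z) + ⟪trB (B z), φ z⟫_ℝ) V :=
    (h.integrable_hsNorm.const_mul _).mono' hmeas hbd
  have hkey := h.orthogonal φ hφ
  rw [integral_add hint' hint] at hkey
  have heq : ∫ z, derivPointDot φ z ∂V +
      ∫ z, ⟪innerNormal Ω z.1, φ (z.1, wedge (innerNormal Ω z.1) z.2)⟫_ℝ ∂Γ =
      -∫ z, derivPlaneDot φ z (B z) + ⟪trB (B z), φ z⟫_ℝ ∂V := by linarith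
  rw [heq, abs_neg, ← integral_const_mul]
  exact norm_integral_le_of_norm_le (h.integrable_hsNorm.const_mul _) hbd

/-! ### The boundary of the domain -/

theorem IsDefiningFunction.contDiffAt {x : Euc n} {ρ : Euc n → ℝ} {U : Set (Euc n)}
    (h : IsDefiningFunction Ω x ρ U) {y : Euc n} (hy : y ∈ U) : ContDiffAt ℝ 2 ρ y :=
  h.contDiffOn.contDiffAt (h.isOpen.mem_nhds hy)

theorem fderiv_eq_innerSL_gradient (ρ : Euc n → ℝ) (x : Euc n) :
    fderiv ℝ ρ x = innerSL ℝ (gradient ρ x) := by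
  ext w
  rw [gradient, innerSL_apply_apply, InnerProductSpace.toDual_symm_apply]

theorem norm_innerNormal (hΩ : IsBoundedC2Domain Ω) {x : Euc n} (hx : x ∈ frontier Ω) :
    ‖innerNormal Ω x‖ = 1 := by
  obtain ⟨ρ, U, h⟩ := hΩ.exists_definingFunction x hx
  rw [innerNormal_eq hΩ.isOpen hx h, norm_smul, norm_inv, norm_norm,
    inv_mul_cancel₀ (norm_ne_zero_iff.2 h.gradient_ne_zero)]

/-- A localized defining function: a globally defined `C²` function that vanishes on `∂Ω`, whose
derivative at the points of `∂Ω` is a nonnegative multiple of the interior normal, and a positive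
one near `x`. -/
theorem exists_localized_definingFunction (hΩ : IsBoundedC2Domain Ω) {x : Euc n}
    (hx : x ∈ frontier Ω) : ∃ F : Euc n → ℝ, ContDiff ℝ 2 F ∧ ∃ N ∈ 𝓝 x,
      ∀ y ∈ frontier Ω, F y = 0 ∧ ∃ c : ℝ, 0 ≤ c ∧ (y ∈ N → 0 < c) ∧
        HasFDerivAt F (c • innerSL ℝ (innerNormal Ω y)) y := by
  obtain ⟨ρ, U, h⟩ := hΩ.exists_definingFunction x hx
  have hcont : ContinuousAt (fderiv ℝ ρ) x :=
    ((h.contDiffAt h.mem).fderiv_right (m := 1) (by norm_num)).continuousAt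
  have hne : fderiv ℝ ρ x ≠ 0 := fun h0 => h.gradient_ne_zero (by simp [gradient, h0])
  have hU : {y | y ∈ U ∧ fderiv ℝ ρ y ≠ 0} ∈ 𝓝 x :=
    Filter.inter_mem (h.isOpen.mem_nhds h.mem) (hcont.eventually_ne hne)
  obtain ⟨f, hfs, -, hf, hfr, hfx⟩ := exists_contDiff_tsupport_subset (n := 2) hU
  have hf0 : ∀ y, 0 ≤ f y := fun y => (hfr ⟨y, rfl⟩).1
  have hout : ∀ y, y ∉ tsupport f → (fun y => f y * ρ y) =ᶠ[𝓝 y] fun _ => 0 := fun y hy => by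
    filter_upwards [(isClosed_tsupport f).isOpen_compl.mem_nhds hy] with z hz
    rw [image_eq_zero_of_notMem_tsupport hz, zero_mul]
  refine ⟨fun y => f y * ρ y, ?_, {y | f y ≠ 0},
    hf.continuous.continuousAt.eventually_ne (by rw [hfx]; exact one_ne_zero), ?_⟩
  · refine contDiff_iff_contDiffAt.2 fun y => ?_
    by_cases hy : y ∈ tsupport f
    · exact hf.contDiffAt.mul (h.contDiffAt (hfs hy).1)
    · exact contDiffAt_const.congr_of_eventuallyEq (hout y hy)
  · intro y hyS
    by_cases hy : y ∈ tsupport f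
    · obtain ⟨hyU, hy0⟩ := hfs hy
      have hg : gradient ρ y ≠ 0 := fun h0 => hy0 (by
        rw [fderiv_eq_innerSL_gradient, h0, map_zero])
      have h' : IsDefiningFunction Ω y ρ U := ⟨h.isOpen, hyU, h.contDiffOn, h.mem_iff, hg⟩
      have hρ : ρ y = 0 := h'.eq_zero hΩ.isOpen hyS
      refine ⟨by simp [hρ], f y * ‖gradient ρ y‖, by have := hf0 y; positivity, fun hfy => ?_, ?_⟩
      · exact mul_pos ((hf0 y).lt_of_ne' hfy) (norm_pos_iff.2 hg)
      · have h1 := ((hf.differentiable (by norm_num)) y).hasFDerivAt.mul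
          ((h.contDiffAt hyU).differentiableAt (by norm_num)).hasFDerivAt
        refine h1.congr_fderiv ?_
        rw [hρ, zero_smul, add_zero, innerNormal_eq hΩ.isOpen hyS h', map_smul, smul_smul,
          mul_assoc, mul_inv_cancel₀ (norm_ne_zero_iff.2 hg), mul_one, fderiv_eq_innerSL_gradient]
    · refine ⟨by simp [image_eq_zero_of_notMem_tsupport hy], 0, le_rfl,
        fun h0 => absurd (image_eq_zero_of_notMem_tsupport hy) h0, ?_⟩
      rw [zero_smul]
      exact (hasFDerivAt_const (0 : ℝ) y).congr_of_eventuallyEq (hout y hy)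

/-- A bounded `C²` domain has a global `C²` function that vanishes on `∂Ω` and whose gradient is
there a positive multiple of the interior normal. -/
theorem exists_global_definingFunction (hΩ : IsBoundedC2Domain Ω) :
    ∃ ρ : Euc n → ℝ, ContDiff ℝ 2 ρ ∧ ∀ x ∈ frontier Ω,
      ρ x = 0 ∧ ∃ c : ℝ, 0 < c ∧ gradient ρ x = c • innerNormal Ω x := by
  have hS : IsCompact (frontier Ω) :=
    Metric.isCompact_of_isClosed_isBounded isClosed_frontier
      (hΩ.isBounded.closure.subset frontier_subset_closure)
  have hloc : ∀ x : frontier Ω, ∃ F : Euc n → ℝ, ContDiff ℝ 2 F ∧ ∃ N ∈ 𝓝 (x : Euc n),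
      ∀ y ∈ frontier Ω, F y = 0 ∧ ∃ c : ℝ, 0 ≤ c ∧ (y ∈ N → 0 < c) ∧
        HasFDerivAt F (c • innerSL ℝ (innerNormal Ω y)) y :=
    fun x => exists_localized_definingFunction hΩ x.2
  choose F hF N hN hFS using hloc
  obtain ⟨t, ht⟩ := hS.elim_nhds_subcover' (fun x hx => N ⟨x, hx⟩) fun x hx => hN ⟨x, hx⟩
  refine ⟨fun y => ∑ x ∈ t, F x y, ContDiff.sum fun x _ => hF x, fun y hy => ?_⟩
  refine ⟨Finset.sum_eq_zero fun x _ => (hFS x y hy).1, ?_⟩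
  have hc := fun x => (hFS x y hy).2
  choose c hc0 hcN hcF using hc
  refine ⟨∑ x ∈ t, c x, ?_, ?_⟩
  · obtain ⟨x, hx, hyx⟩ := Set.mem_iUnion₂.1 (ht hy)
    exact Finset.sum_pos' (fun x _ => hc0 x) ⟨x, hx, hcN x hyx⟩
  · have h1 := (HasFDerivAt.fun_sum (u := t) fun x _ => hcF x).fderiv
    rw [← Finset.sum_smul, ← map_smul, fderiv_eq_innerSL_gradient] at h1
    exact innerSL_inj.1 h1

theorem contDiff_gradient {ρ : Euc n → ℝ} (hρ : ContDiff ℝ 2 ρ) : ContDiff ℝ 1 (gradient ρ) :=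
  (InnerProductSpace.toDual ℝ (Euc n)).symm.contDiff.comp (hρ.fderiv_right (by norm_num))

/-- Moving from a boundary point in the direction of the exterior normal leaves `Ω̄`. -/
theorem eventually_notMem_closure (hΩ : IsBoundedC2Domain Ω) {x : Euc n}
    (hx : x ∈ frontier Ω) :
    ∀ᶠ t in 𝓝[>] (0 : ℝ), x - t • innerNormal Ω x ∉ closure Ω := by
  obtain ⟨ρ, U, h⟩ := hΩ.exists_definingFunction x hx
  have hρ := h.eq_zero hΩ.isOpen hx
  have hline : HasDerivAt (fun t : ℝ => x - t • innerNormal Ω x) (-innerNormal Ω x) 0 := by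
    simpa using ((hasDerivAt_id (0 : ℝ)).smul_const (innerNormal Ω x)).const_sub x
  have hd : HasFDerivAt ρ (fderiv ℝ ρ x) (x - (0 : ℝ) • innerNormal Ω x) := by
    rw [zero_smul, sub_zero]
    exact ((h.contDiffAt h.mem).differentiableAt (by norm_num)).hasFDerivAt
  have hcomp := hd.comp_hasDerivAt (0 : ℝ) hline
  have hneg : fderiv ℝ ρ x (-innerNormal Ω x) < 0 := by
    rw [fderiv_eq_innerSL_gradient, innerSL_apply_apply, innerNormal_eq hΩ.isOpen hx h,
      inner_neg_right, real_inner_smul_right, real_inner_self_eq_norm_sq]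
    have := norm_pos_iff.2 h.gradient_ne_zero
    have : 0 < ‖gradient ρ x‖⁻¹ * ‖gradient ρ x‖ ^ 2 := by positivity
    linarith
  have h1 := (hasDerivAt_iff_tendsto_slope.1 hcomp).mono_left
    (nhdsWithin_mono (0 : ℝ) fun t (ht : t ∈ Set.Ioi (0 : ℝ)) => ne_of_gt ht)
  have hU : ∀ᶠ t in 𝓝[>] (0 : ℝ), x - t • innerNormal Ω x ∈ U := by
    refine (hline.continuousAt.eventually ?_).filter_mono nhdsWithin_le_nhds
    simpa using h.isOpen.mem_nhds h.mem
  filter_upwards [h1.eventually (gt_mem_nhds hneg), self_mem_nhdsWithin, hU] with t ht ht0 htU hmem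
  have ht0' : (0 : ℝ) < t := ht0
  simp only [slope_def_field, Function.comp_apply, zero_smul, sub_zero, hρ] at ht
  have hlt : ρ (x - t • innerNormal Ω x) < 0 := by
    by_contra hcon
    exact absurd ht (not_lt.2 (div_nonneg (not_lt.1 hcon) ht0'.le))
  have hev : ∀ᶠ y in 𝓝 (x - t • innerNormal Ω x), y ∉ Ω := by
    filter_upwards [h.isOpen.mem_nhds htU,
      (h.contDiffAt htU).continuousAt.eventually (gt_mem_nhds hlt)] with y hy hy' hm
    exact absurd ((h.mem_iff y hy).1 hm) (not_lt.2 hy'.le)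
  obtain ⟨y, hyΩ, hy⟩ := ((mem_closure_iff_frequently.1 hmem).and_eventually hev).exists
  exact hy hyΩ

/-- The pairs `(x, P)` with `x ∈ ∂Ω` and `ν(x) ∈ P`, for which the plane `P` meets the boundary
orthogonally at `x`. The rank of the projection `P` is left free. -/
def conormalSet (Ω : Set (Euc n)) : Set (Euc n × Mat n) :=
  {z | z.1 ∈ frontier Ω ∧ IsStarProjection z.2 ∧ z.2 (innerNormal Ω z.1) = innerNormal Ω z.1}

theorem mem_conormalSet_iff_mem_range {P : Mat n} (hP : IsStarProjection P) {x : Euc n} :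
    (x, P) ∈ conormalSet Ω ↔ x ∈ frontier Ω ∧ innerNormal Ω x ∈ P.range := by
  refine and_congr_right fun _ => ?_
  constructor
  · rintro ⟨-, h⟩
    exact ⟨_, h⟩
  · rintro ⟨y, hy⟩
    refine ⟨hP, ?_⟩
    have hy' : P y = innerNormal Ω x := hy
    change P (innerNormal Ω x) = innerNormal Ω x
    rw [← hy', ← mul_apply_eq_comp, hP.isIdempotentElem.eq]

theorem isClosed_conormalSet (hΩ : IsBoundedC2Domain Ω) : IsClosed (conormalSet Ω) := by
  obtain ⟨ρ, hρ, hS⟩ := exists_global_definingFunction hΩ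
  have hg : Continuous (gradient ρ) := (contDiff_gradient hρ).continuous
  have heq : conormalSet Ω = {z : Euc n × Mat n | z.1 ∈ frontier Ω} ∩
      {z : Euc n × Mat n | z.2 * z.2 = z.2} ∩ {z : Euc n × Mat n | star z.2 = z.2} ∩
      {z : Euc n × Mat n | z.2 (gradient ρ z.1) = gradient ρ z.1} := by
    ext z
    constructor
    · rintro ⟨h1, h2, h3⟩
      obtain ⟨-, c, -, hgc⟩ := hS _ h1
      refine ⟨⟨⟨h1, h2.isIdempotentElem⟩, h2.isSelfAdjoint⟩, ?_⟩
      change z.2 (gradient ρ z.1) = gradient ρ z.1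
      rw [hgc, map_smul, h3]
    · rintro ⟨⟨⟨h1, h2⟩, h3⟩, h4⟩
      obtain ⟨-, c, hc, hgc⟩ := hS _ h1
      refine ⟨h1, ⟨h2, h3⟩, ?_⟩
      have h4' : z.2 (gradient ρ z.1) = gradient ρ z.1 := h4
      rw [hgc, map_smul] at h4'
      exact smul_right_injective _ hc.ne' h4'
  rw [heq]
  refine (((isClosed_frontier.preimage continuous_fst).inter
    (isClosed_eq (continuous_snd.mul continuous_snd) continuous_snd)).inter
    (isClosed_eq (continuous_star.comp continuous_snd) continuous_snd)).inter
    (isClosed_eq ?_ (hg.comp continuous_fst))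
  exact continuous_snd.clm_apply (hg.comp continuous_fst)

theorem wedge_mem_conormalSet {x : Euc n} (hx : x ∈ frontier Ω) (Q : Mat n) :
    (x, wedge (innerNormal Ω x) Q) ∈ conormalSet Ω := by
  refine ⟨hx, isStarProjection_starProjection, ?_⟩
  exact Submodule.starProjection_eq_self_iff.2
    (Submodule.mem_sup_left (Submodule.mem_span_singleton_self _))

/-! ### Limits of varifolds with vanishing curvature -/

/-- A probability measure on the planes over `Ω̄` whose first variation vanishes on all vector
fields `φ(x, P)` that are tangential to `∂Ω` wherever the plane `P` is orthogonal to `∂Ω`. Weak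
limits of orthogonal varifolds of mass one whose curvature tends to zero are of this kind. -/
structure IsFlatVarifold (m : ℕ) (Ω : Set (Euc n)) (V : Measure (Euc n × Mat n)) : Prop where
  isProbabilityMeasure : IsProbabilityMeasure V
  support_V : V (closure Ω ×ˢ Grassmannian m n)ᶜ = 0
  stationary : ∀ φ : Euc n × Mat n → Euc n, ContDiff ℝ 1 φ →
    (∀ z ∈ conormalSet Ω, ⟪innerNormal Ω z.1, φ z⟫_ℝ = 0) → ∫ z, derivPointDot φ z ∂V = 0

theorem IsOrthogonalCurvatureVarifold.ae_mem_frontier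
    (h : IsOrthogonalCurvatureVarifold m Ω V B Γ) : ∀ᵐ z ∂Γ, z.1 ∈ frontier Ω := by
  have h0 : ∀ᵐ z ∂Γ, z ∈ boundaryBundle m Ω := h.support_Γ
  exact h0.mono fun z hz => hz.1

/-- Jensen's inequality for the curvature of a varifold of mass one. -/
theorem ofReal_integral_hsNorm_le_rpow [IsProbabilityMeasure V]
    (hB : AEStronglyMeasurable B V) {p : ℝ} (hp : 1 ≤ p) :
    ENNReal.ofReal (∫ z, hsNorm (B z) ∂V) ≤ curvatureEnergy p V B ^ (1 / p) := by
  have hm : AEStronglyMeasurable (fun z => hsNorm (B z)) V :=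
    continuous_hsNorm.comp_aestronglyMeasurable hB
  have h1 := eLpNorm'_le_eLpNorm'_of_exponent_le one_pos hp V hm
  have h2 : eLpNorm' (fun z => hsNorm (B z)) p V = curvatureEnergy p V B ^ (1 / p) := by
    rw [eLpNorm'_eq_lintegral_enorm, curvatureEnergy]
    congr 1
    refine lintegral_congr fun z => ?_
    rw [Real.enorm_eq_ofReal (hsNorm_nonneg _),
      ENNReal.ofReal_rpow_of_nonneg (hsNorm_nonneg _) (by linarith)]
  rw [h2] at h1
  refine le_trans ?_ h1
  simp only [eLpNorm'_eq_lintegral_enorm, ENNReal.rpow_one, div_one]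
  rw [integral_eq_lintegral_of_nonneg_ae (ae_of_all _ fun z => hsNorm_nonneg _) hm]
  refine ENNReal.ofReal_toReal_le.trans (le_of_eq (lintegral_congr fun z => ?_))
  rw [Real.enorm_eq_ofReal (hsNorm_nonneg _)]

/-- Weak convergence of probability measures on the planes over `Ω̄` tests against all continuous
functions, bounded or not. -/
theorem tendsto_integral_of_support (hΩ : Bornology.IsBounded Ω) {ι : Type*} {l : Filter ι}
    {W : ι → ProbabilityMeasure (Euc n × Mat n)} {W₀ : ProbabilityMeasure (Euc n × Mat n)}
    (hW : Tendsto W l (𝓝 W₀))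
    (hs : ∀ i, (W i : Measure (Euc n × Mat n)) (closure Ω ×ˢ Grassmannian m n)ᶜ = 0)
    (hs₀ : (W₀ : Measure (Euc n × Mat n)) (closure Ω ×ˢ Grassmannian m n)ᶜ = 0)
    {f : Euc n × Mat n → ℝ} (hf : Continuous f) :
    Tendsto (fun i => ∫ z, f z ∂(W i : Measure (Euc n × Mat n))) l
      (𝓝 (∫ z, f z ∂(W₀ : Measure (Euc n × Mat n)))) := by
  obtain ⟨C, hC⟩ := (isCompact_planeBundle (m := m) hΩ).exists_bound_of_continuousOn hf.continuousOn
  let g : BoundedContinuousFunction (Euc n × Mat n) ℝ :=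
    BoundedContinuousFunction.ofNormedAddCommGroup (fun z => max (-|C|) (min |C| (f z)))
      (by fun_prop) |C| fun z => by
        rw [Real.norm_eq_abs, abs_le]
        exact ⟨le_max_left _ _, max_le (by linarith [abs_nonneg C]) (min_le_left _ _)⟩
  have hfg : ∀ z ∈ closure Ω ×ˢ Grassmannian m n, g z = f z := fun z hz => by
    have h1 := abs_le.1 ((hC z hz).trans (le_abs_self C))
    change max (-|C|) (min |C| (f z)) = f z
    rw [min_eq_right h1.2, max_eq_right h1.1]
  have hlim := (ProbabilityMeasure.tendsto_iff_forall_integral_tendsto.1 hW) g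
  rw [integral_congr_ae ((ae_mem_of_support hs₀).mono hfg)] at hlim
  exact hlim.congr fun i => integral_congr_ae ((ae_mem_of_support (hs i)).mono hfg)

/-- Boundary varifolds need not converge here: the test fields in the definition of a flat varifold
do not see them. -/
theorem exists_isFlatVarifold_of_kappa_eq_zero (hΩ : IsBoundedC2Domain Ω) {p : ℝ} (hp : 1 ≤ p)
    (hκ : kappa m p Ω = 0) : ∃ V : Measure (Euc n × Mat n), IsFlatVarifold m Ω V := by
  have hex : ∀ k : ℕ, ∃ V B Γ, IsOrthogonalCurvatureVarifold m Ω V B Γ ∧ mass V = 1 ∧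
      curvatureEnergy p V B < ((k : ℝ≥0∞) + 1)⁻¹ := by
    intro k
    have hpos : kappa m p Ω < ((k : ℝ≥0∞) + 1)⁻¹ := by
      rw [hκ, ENNReal.inv_pos]
      finiteness
    obtain ⟨E, ⟨V, B, Γ, h, hV, rfl⟩, hE⟩ := sInf_lt_iff.1 hpos
    exact ⟨V, B, Γ, h, hV, hE⟩
  choose V B Γ h hV hE using hex
  have hprob : ∀ k, IsProbabilityMeasure (V k) := fun k => ⟨hV k⟩
  have hcurv : Tendsto (fun k => ∫ z, hsNorm (B k z) ∂V k) atTop (𝓝 0) := by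
    have h0 : Tendsto (fun k => curvatureEnergy p (V k) (B k)) atTop (𝓝 0) := by
      refine tendsto_of_tendsto_of_tendsto_of_le_of_le tendsto_const_nhds ?_
        (fun _ => zero_le) fun k => (hE k).le
      have := (ENNReal.tendsto_inv_nat_nhds_zero).comp (tendsto_add_atTop_nat 1)
      refine this.congr fun k => ?_
      simp
    have h1 : Tendsto (fun k => curvatureEnergy p (V k) (B k) ^ (1 / p)) atTop (𝓝 0) := by
      have := h0.ennrpow_const (1 / p)
      rwa [ENNReal.zero_rpow_of_pos (by positivity)] at this
    have h2 : Tendsto (fun k => ENNReal.ofReal (∫ z, hsNorm (B k z) ∂V k)) atTop (𝓝 0) :=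
      tendsto_of_tendsto_of_tendsto_of_le_of_le tendsto_const_nhds h1 (fun _ => zero_le)
        fun k => ofReal_integral_hsNorm_le_rpow (h k).integrable_B.1 hp
    refine ((ENNReal.tendsto_toReal ENNReal.zero_ne_top).comp h2).congr fun k => ?_
    exact ENNReal.toReal_ofReal (integral_nonneg fun z => hsNorm_nonneg _)
  -- By Prokhorov's theorem there is a weak limit along an ultrafilter.
  let W : ℕ → ProbabilityMeasure (Euc n × Mat n) := fun k => ⟨V k, hprob k⟩
  have hcpt := isCompact_setOfPred_probabilityMeasure_mass_eq_compl_isCompact_le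
    (E := Euc n × Mat n) (u := fun _ => 0) (K := fun _ => closure Ω ×ˢ Grassmannian m n)
    tendsto_const_nhds (fun _ => isCompact_planeBundle hΩ.isBounded) (Or.inl inferInstance)
  obtain ⟨W₀, hW₀, hlim⟩ := hcpt.ultrafilter_le_nhds ((hyperfilter ℕ).map W) (by
    rw [Ultrafilter.coe_map, le_principal_iff, mem_map]
    refine Filter.univ_mem' fun k _ => ?_
    have := (h k).support_V
    simp [W, this])
  have hW₀' : (W₀ : Measure (Euc n × Mat n)) (closure Ω ×ˢ Grassmannian m n)ᶜ = 0 := by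
    have := hW₀ 0
    simpa [ProbabilityMeasure.coeFn_def, ENNReal.toNNReal_eq_zero_iff] using this
  refine ⟨W₀, inferInstance, hW₀', fun φ hφ hφν => ?_⟩
  have hconv : Tendsto (fun k => ∫ z, derivPointDot φ z ∂V k) (hyperfilter ℕ)
      (𝓝 (∫ z, derivPointDot φ z ∂(W₀ : Measure (Euc n × Mat n)))) :=
    tendsto_integral_of_support (m := m) hΩ.isBounded (W := W) hlim (fun k => (h k).support_V)
      hW₀' (continuous_derivPointDot hφ)
  obtain ⟨M₁, hM₁⟩ := (isCompact_planeBundle (m := m) hΩ.isBounded).exists_bound_of_continuousOn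
    (hφ.continuous_fderiv (by norm_num)).continuousOn
  obtain ⟨M₂, hM₂⟩ := (isCompact_planeBundle (m := m) hΩ.isBounded).exists_bound_of_continuousOn
    hφ.continuous.continuousOn
  have hbound : ∀ k, ‖∫ z, derivPointDot φ z ∂V k‖ ≤
      (n * n + n) * max M₁ M₂ * ∫ z, hsNorm (B k z) ∂V k := by
    intro k
    have h1 := (h k).abs_firstVariation_le hΩ.isBounded hφ (M := max M₁ M₂) fun z hz =>
      ⟨(hM₁ z hz).trans (le_max_left _ _), (hM₂ z hz).trans (le_max_right _ _)⟩
    have h2 : ∫ z, ⟪innerNormal Ω z.1, φ (z.1, wedge (innerNormal Ω z.1) z.2)⟫_ℝ ∂(Γ k) = 0 := by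
      refine integral_eq_zero_of_ae ?_
      filter_upwards [(h k).ae_mem_frontier] with z hz
      exact hφν _ (wedge_mem_conormalSet hz _)
    rwa [h2, add_zero] at h1
  have hzero : Tendsto (fun k => ∫ z, derivPointDot φ z ∂V k) atTop (𝓝 0) := by
    refine squeeze_zero_norm hbound ?_
    simpa using hcurv.const_mul ((n * n + n) * max M₁ M₂)
  exact tendsto_nhds_unique hconv (hzero.mono_left Nat.hyperfilter_le_atTop)

/-! ### The support of a flat varifold -/

/-- The horizontal shear `(x, P) ↦ (x - t P v, P)`, which moves every point inside the plane
attached to it. -/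
noncomputable def planeShear {n : ℕ} (v : Euc n) (t : ℝ) : (Euc n × Mat n) →L[ℝ] (Euc n × Mat n) :=
  (ContinuousLinearMap.fst ℝ (Euc n) (Mat n) -
    t • (ContinuousLinearMap.apply ℝ (Euc n) v).comp
      (ContinuousLinearMap.snd ℝ (Euc n) (Mat n))).prod
    (ContinuousLinearMap.snd ℝ (Euc n) (Mat n))

theorem planeShear_apply (v : Euc n) (t : ℝ) (z : Euc n × Mat n) :
    planeShear v t z = (z.1 - t • z.2 v, z.2) := rfl

theorem norm_apply_le_of_isStarProjection {P : Mat n} (hP : IsStarProjection P) (v : Euc n) :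
    ‖P v‖ ≤ ‖v‖ := by
  simpa using P.le_of_opNorm_le (IsStarProjection.norm_le P hP) v

theorem hasDerivAt_comp_planeShear {f : Euc n × Mat n → ℝ} (hf : ContDiff ℝ 1 f) (v : Euc n)
    (z : Euc n × Mat n) (t : ℝ) :
    HasDerivAt (fun t => f (planeShear v t z))
      (-derivPointDot (fun z => f (planeShear v t z) • v) z) t := by
  have hdiff : Differentiable ℝ f := hf.differentiable (by norm_num)
  have hcomp : HasFDerivAt (fun z => f (planeShear v t z))
      ((fderiv ℝ f (planeShear v t z)).comp (planeShear v t)) z :=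
    (hdiff _).hasFDerivAt.comp z (planeShear v t).hasFDerivAt
  rw [derivPointDot_smul_const hcomp.differentiableAt, hcomp.fderiv]
  have hline : HasDerivAt (fun t => planeShear v t z) (-(z.2 v), (0 : Mat n)) t := by
    simp only [planeShear_apply]
    have h1 : HasDerivAt (fun t : ℝ => z.1 - t • z.2 v) (-(z.2 v)) t := by
      simpa using ((hasDerivAt_id t).smul_const (z.2 v)).const_sub z.1
    exact h1.prodMk (hasDerivAt_const t z.2)
  refine ((hdiff _).hasFDerivAt.comp_hasDerivAt t hline).congr_deriv ?_
  have hz : planeShear v t (z.2 v, (0 : Mat n)) = (z.2 v, 0) := by simp [planeShear_apply]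
  rw [ContinuousLinearMap.comp_apply, hz, ← map_neg (fderiv ℝ f _), Prod.neg_mk, neg_zero]

/-- A flat varifold is invariant under horizontal shears, as long as the test function stays away
from the planes orthogonal to the boundary. -/
theorem IsFlatVarifold.integral_comp_planeShear (hΩ : Bornology.IsBounded Ω)
    (h : IsFlatVarifold m Ω V)
    {f : Euc n × Mat n → ℝ} (hf : ContDiff ℝ 1 f) (hfc : HasCompactSupport f) {v : Euc n}
    (hv : ∀ t ∈ Set.Icc (0 : ℝ) 1, ∀ z ∈ conormalSet Ω, f (planeShear v t z) = 0) :
    ∫ z, f (planeShear v 1 z) ∂V = ∫ z, f z ∂V := by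
  have := h.isProbabilityMeasure
  have hcont : ∀ t : ℝ, Continuous fun z => f (planeShear v t z) := fun t =>
    hf.continuous.comp (planeShear v t).continuous
  have hC1 : ∀ t : ℝ, ContDiff ℝ 1 fun z => f (planeShear v t z) • v := fun t =>
    (hf.comp (planeShear v t).contDiff).smul contDiff_const
  obtain ⟨C, hC⟩ := (hfc.fderiv ℝ).exists_bound_of_continuous (hf.continuous_fderiv (by norm_num))
  have hbound : ∀ᵐ z ∂V, ∀ t ∈ (Set.univ : Set ℝ),
      ‖-derivPointDot (fun z => f (planeShear v t z) • v) z‖ ≤ C * ‖v‖ := by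
    filter_upwards [ae_mem_of_support h.support_V] with z hz t _
    have hcomp : HasFDerivAt (fun z => f (planeShear v t z))
        ((fderiv ℝ f (planeShear v t z)).comp (planeShear v t)) z :=
      ((hf.differentiable (by norm_num)) _).hasFDerivAt.comp z (planeShear v t).hasFDerivAt
    rw [norm_neg, derivPointDot_smul_const hcomp.differentiableAt, hcomp.fderiv,
      ContinuousLinearMap.comp_apply]
    refine (ContinuousLinearMap.le_of_opNorm_le _ (hC _) _).trans ?_
    have h0 : 0 ≤ C := (norm_nonneg _).trans (hC z)
    gcongr
    simpa [planeShear_apply] using norm_apply_le_of_isStarProjection hz.2.1 v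
  have hderiv : ∀ t : ℝ, HasDerivAt (fun t => ∫ z, f (planeShear v t z) ∂V)
      (∫ z, -derivPointDot (fun z => f (planeShear v t z) • v) z ∂V) t := fun t =>
    (hasDerivAt_integral_of_dominated_loc_of_deriv_le (bound := fun _ => C * ‖v‖)
      (F' := fun t z => -derivPointDot (fun z => f (planeShear v t z) • v) z) univ_mem
      (Eventually.of_forall fun s => (hcont s).aestronglyMeasurable)
      (integrable_of_continuous_of_support hΩ h.support_V (hcont t))
      (continuous_derivPointDot (hC1 t)).neg.aestronglyMeasurable hbound (integrable_const _)
      (ae_of_all _ fun z t _ => hasDerivAt_comp_planeShear hf v z t)).2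
  have hzero : ∀ t ∈ Set.Icc (0 : ℝ) 1, HasDerivAt (fun t => ∫ z, f (planeShear v t z) ∂V) 0 t := by
    intro t ht
    have h1 := hderiv t
    rwa [integral_neg, h.stationary _ (hC1 t) (fun z hz => by
      rw [hv t ht z hz, zero_smul, inner_zero_right]), neg_zero] at h1
  have hconst := constant_of_has_deriv_right_zero (a := (0 : ℝ)) (b := 1)
    (fun t ht => (hzero t ht).continuousAt.continuousWithinAt)
    (fun t ht => (hzero t ⟨ht.1, ht.2.le⟩).hasDerivWithinAt) 1 ⟨zero_le_one, le_rfl⟩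
  simpa [planeShear_apply] using hconst

/-- Away from the planes orthogonal to the boundary, the support of a flat varifold contains with
`(x, P)` a whole neighbourhood of `x` in `x + P`. -/
theorem IsFlatVarifold.exists_add_mem_support (hΩ : IsBoundedC2Domain Ω)
    (h : IsFlatVarifold m Ω V) {x : Euc n} {P : Mat n} (hz : (x, P) ∈ V.support)
    (hW : (x, P) ∉ conormalSet Ω) :
    ∃ r > 0, ∀ v, P v = v → ‖v‖ < r → (x + v, P) ∈ V.support := by
  have := h.isProbabilityMeasure
  obtain ⟨ε, hε, hball⟩ := Metric.isOpen_iff.1 (isClosed_conormalSet hΩ).isOpen_compl _ hW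
  refine ⟨ε / 2, by positivity, fun v hPv hv => ?_⟩
  by_contra hnot
  obtain ⟨U, hU, hVU⟩ := Measure.notMem_support_iff_exists.1 hnot
  obtain ⟨δ, hδ, hδU⟩ := Metric.mem_nhds_iff.1 hU
  -- A bump function of radius `η` at `(x, P)`, carried along by `P v`, stays off `conormalSet Ω`
  -- and ends up inside `U`, because the planes close to `P` move `x` by almost `v`.
  obtain ⟨η, hη, hηε, hηδ⟩ : ∃ η > 0, η ≤ ε / 2 ∧ η * (1 + ‖v‖) ≤ δ := by
    refine ⟨min (ε / 2) (δ / (1 + ‖v‖)), by positivity, min_le_left _ _, ?_⟩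
    rw [← le_div_iff₀ (by positivity)]
    exact min_le_right _ _
  obtain ⟨f, hfs, hfc, hf, hfr, hfx⟩ :=
    exists_contDiff_tsupport_subset (n := 1) (Metric.ball_mem_nhds (x, P) hη)
  have hfball : ∀ z, f z ≠ 0 → ‖z.1 - x‖ < η ∧ ‖z.2 - P‖ < η := fun z hz => by
    have h1 : z ∈ Metric.ball (x, P) η := hfs (subset_tsupport f hz)
    rw [Metric.mem_ball, Prod.dist_eq, max_lt_iff, dist_eq_norm, dist_eq_norm] at h1
    exact h1
  have hinv := h.integral_comp_planeShear hΩ.isBounded hf hfc (v := v) (by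
    intro t ht z hz
    by_contra hne
    obtain ⟨h1, h2⟩ := hfball _ hne
    rw [planeShear_apply] at h1 h2
    refine hball ?_ hz
    rw [Metric.mem_ball, Prod.dist_eq, max_lt_iff, dist_eq_norm, dist_eq_norm]
    refine ⟨?_, by simp only at h2 ⊢; linarith⟩
    have h3 : ‖t • z.2 v‖ ≤ ‖v‖ := by
      rw [norm_smul, Real.norm_of_nonneg ht.1]
      exact (mul_le_of_le_one_left (norm_nonneg _) ht.2).trans
        (norm_apply_le_of_isStarProjection hz.2.1 v)
    calc ‖z.1 - x‖ = ‖(z.1 - t • z.2 v - x) + t • z.2 v‖ := by congr 1; abel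
      _ ≤ ‖z.1 - t • z.2 v - x‖ + ‖t • z.2 v‖ := norm_add_le _ _
      _ < ε := by simp only at h1; linarith)
  have hzero : ∫ z, f (planeShear v 1 z) ∂V = 0 := by
    refine integral_eq_zero_of_ae ?_
    have hUae : ∀ᵐ z ∂V, z ∉ U := measure_eq_zero_iff_ae_notMem.1 hVU
    filter_upwards [hUae, ae_mem_of_support h.support_V] with z hzU hzK
    by_contra hne
    obtain ⟨h1, h2⟩ := hfball _ hne
    simp only [planeShear_apply, one_smul] at h1 h2
    refine hzU (hδU ?_)
    rw [Metric.mem_ball, Prod.dist_eq, max_lt_iff, dist_eq_norm, dist_eq_norm]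
    have h3 : ‖(z.2 - P) v‖ ≤ η * ‖v‖ := ContinuousLinearMap.le_of_opNorm_le _ h2.le v
    have h4 : 0 ≤ η * ‖v‖ := by positivity
    refine ⟨?_, by simp only; linarith⟩
    calc ‖z.1 - (x + v)‖ = ‖(z.1 - z.2 v - x) + (z.2 - P) v‖ := by
          congr 1
          rw [sub_apply, hPv]
          abel
      _ ≤ ‖z.1 - z.2 v - x‖ + ‖(z.2 - P) v‖ := norm_add_le _ _
      _ < δ := by linarith
  have hpos : 0 < ∫ z, f z ∂V := by
    rw [integral_pos_iff_support_of_nonneg (fun z => (hfr ⟨z, rfl⟩).1)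
      (integrable_of_continuous_of_support hΩ.isBounded h.support_V hf.continuous)]
    refine Measure.mem_support_iff_forall _ |>.1 hz _ ?_
    exact hf.continuous.continuousAt.eventually_ne (by rw [hfx]; exact one_ne_zero)
  linarith

/-- A flat varifold does not live on the planes that are orthogonal to the boundary: for a defining
function `ρ`, the field `ρ ∇ρ` is admissible and its divergence along such planes is `|∇ρ|²`. -/
theorem IsFlatVarifold.exists_mem_support_notMem_conormalSet (hΩ : IsBoundedC2Domain Ω)
    (h : IsFlatVarifold m Ω V) : ∃ z ∈ V.support, z ∉ conormalSet Ω := by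
  have := h.isProbabilityMeasure
  by_contra! hcon
  have hae : ∀ᵐ z ∂V, z ∈ conormalSet Ω :=
    mem_of_superset Measure.support_mem_ae hcon
  obtain ⟨ρ, hρ, hS⟩ := exists_global_definingFunction hΩ
  have hg := contDiff_gradient hρ
  have hφ : ContDiff ℝ 1 fun z : Euc n × Mat n => ρ z.1 • gradient ρ z.1 :=
    ((hρ.of_le (by norm_num)).comp contDiff_fst).smul (hg.comp contDiff_fst)
  have hint := h.stationary _ hφ fun z hz => by rw [(hS _ hz.1).1, zero_smul, inner_zero_right]
  have hdiv : ∀ z ∈ conormalSet Ω,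
      derivPointDot (fun z : Euc n × Mat n => ρ z.1 • gradient ρ z.1) z =
        ‖gradient ρ z.1‖ ^ 2 := by
    rintro ⟨x, P⟩ ⟨hx, hP, hPν⟩
    obtain ⟨hρ0, c, hc, hgc⟩ := hS x hx
    have hPg : P (gradient ρ x) = gradient ρ x := by
      rw [hgc, map_smul]
      exact congrArg _ hPν
    have h1 : HasFDerivAt (fun z : Euc n × Mat n => ρ z.1)
        ((fderiv ℝ ρ x).comp (ContinuousLinearMap.fst ℝ (Euc n) (Mat n))) (x, P) :=
      ((hρ.differentiable (by norm_num)) x).hasFDerivAt.comp (x, P) hasFDerivAt_fst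
    have h2 : HasFDerivAt (fun z : Euc n × Mat n => gradient ρ z.1)
        ((fderiv ℝ (gradient ρ) x).comp (ContinuousLinearMap.fst ℝ (Euc n) (Mat n))) (x, P) :=
      HasFDerivAt.comp (g := gradient ρ) (f := Prod.fst) (x, P)
        ((hg.differentiable (by norm_num)) x).hasFDerivAt hasFDerivAt_fst
    have h3 : ∀ w : Euc n, fderiv ℝ (fun z : Euc n × Mat n => ρ z.1 • gradient ρ z.1) (x, P)
        (w, 0) = ⟪gradient ρ x, w⟫_ℝ • gradient ρ x := fun w => by
      rw [(h1.fun_smul h2).fderiv, hρ0, zero_smul, zero_add, ContinuousLinearMap.smulRight_apply,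
        ContinuousLinearMap.comp_apply, ContinuousLinearMap.coe_fst', fderiv_eq_innerSL_gradient,
        innerSL_apply_apply]
    rw [derivPointDot]
    calc ∑ i, ⟪fderiv ℝ (fun z : Euc n × Mat n => ρ z.1 • gradient ρ z.1) (x, P)
          (P (stdVec i), 0), stdVec i⟫_ℝ
        = ∑ i, ⟪gradient ρ x, P (⟪gradient ρ x, stdVec i⟫_ℝ • stdVec i)⟫_ℝ := by
          refine Finset.sum_congr rfl fun i _ => ?_
          rw [h3, map_smul, real_inner_smul_left, real_inner_smul_right, mul_comm]
      _ = ‖gradient ρ x‖ ^ 2 := by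
          rw [← inner_sum, ← map_sum, sum_inner_stdVec_smul, hPg, real_inner_self_eq_norm_sq]
  have hne : ∀ x ∈ frontier Ω, gradient ρ x ≠ 0 := fun x hx h0 => by
    obtain ⟨-, c, hc, hgc⟩ := hS x hx
    rw [h0, eq_comm, smul_eq_zero] at hgc
    have hν := norm_innerNormal hΩ hx
    rcases hgc with h1 | h1
    · exact hc.ne' h1
    · rw [h1, norm_zero] at hν
      exact zero_ne_one hν
  have hgint : Integrable (fun z : Euc n × Mat n => ‖gradient ρ z.1‖ ^ 2) V :=
    integrable_of_continuous_of_support hΩ.isBounded h.support_V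
      ((hg.continuous.comp continuous_fst).norm.pow 2)
  rw [integral_congr_ae (hae.mono hdiv), integral_eq_zero_iff_of_nonneg (fun z => by positivity)
    hgint] at hint
  have hfalse : ∀ᵐ _z ∂V, False := by
    filter_upwards [hint, hae] with z hz hzW
    exact hne _ hzW.1 (by simpa using hz)
  exact NeZero.ne V (by simpa [eventually_false_iff_eq_bot] using hfalse)

/-! ### Flat varifolds produce orthogonal slices -/

/-- A point at which the normal lies in the plane `P` is not in the relative interior of the slice,
since the exterior normal leads out of `Ω̄` inside the slicing plane. -/
theorem notMem_sliceInterior (hΩ : IsBoundedC2Domain Ω) {x₀ : Euc n} {P : Mat n}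
    (y : AffineSubspace.mk' x₀ P.range) (hy : ((y : Euc n), P) ∈ conormalSet Ω) :
    y ∉ sliceInterior Ω (AffineSubspace.mk' x₀ P.range) := by
  intro hyI
  have hν : ∀ t : ℝ, -(t • innerNormal Ω (y : Euc n)) ∈
      (AffineSubspace.mk' x₀ P.range).direction := fun t => by
    rw [AffineSubspace.direction_mk']
    exact neg_mem (Submodule.smul_mem _ t ⟨_, hy.2.2⟩)
  let γ : ℝ → AffineSubspace.mk' x₀ P.range := fun t =>
    ⟨(y : Euc n) - t • innerNormal Ω (y : Euc n), by
      have := AffineSubspace.vadd_mem_of_mem_direction (hν t) y.2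
      rwa [vadd_eq_add, neg_add_eq_sub] at this⟩
  have hγ : Continuous γ := by
    refine Continuous.subtype_mk ?_ _
    fun_prop
  have hγ0 : γ 0 = y := Subtype.ext (by simp [γ])
  have h1 : ∀ᶠ t in 𝓝[>] (0 : ℝ), γ t ∈ sliceInterior Ω (AffineSubspace.mk' x₀ P.range) := by
    refine (hγ.continuousAt.eventually ?_).filter_mono nhdsWithin_le_nhds
    rw [hγ0]
    exact isOpen_interior.mem_nhds hyI
  obtain ⟨t, ht1, ht2⟩ := (h1.and (eventually_notMem_closure hΩ hy.1)).exists
  have ht3 : γ t ∈ {y : AffineSubspace.mk' x₀ P.range | (y : Euc n) ∈ closure Ω} :=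
    interior_subset ht1
  exact ht2 ht3

/-- For `(x₀, P)` in the support of a flat varifold, but not in `conormalSet Ω`, the component of
`x₀` in the slice of `Ω̄` by `x₀ + P` is an orthogonal slice. -/
theorem IsFlatVarifold.hasOrthogonalSlice (hΩ : IsBoundedC2Domain Ω) (h : IsFlatVarifold m Ω V) :
    HasOrthogonalSlice m Ω := by
  obtain ⟨⟨x₀, P⟩, hz, hzW⟩ := h.exists_mem_support_notMem_conormalSet hΩ
  have hsub : V.support ⊆ closure Ω ×ˢ Grassmannian m n :=
    Measure.support_subset_of_isClosed (isCompact_planeBundle hΩ.isBounded).isClosed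
      (ae_mem_of_support h.support_V)
  have hPG : P ∈ Grassmannian m n := (hsub hz).2
  set A := AffineSubspace.mk' x₀ P.range
  let a₀ : A := ⟨x₀, AffineSubspace.self_mem_mk' _ _⟩
  have hlc : LocallyConnectedSpace A := by
    have : Nonempty A := ⟨a₀⟩
    exact (IsometryEquiv.vaddConst a₀).toHomeomorph.symm.locallyConnectedSpace
  let F : Set A := {y | ((y : Euc n), P) ∈ V.support}
  have hFclosed : IsClosed F :=
    Measure.isClosed_support.preimage (continuous_subtype_val.prodMk continuous_const)
  have hFopen : ∀ y ∈ F, ((y : Euc n), P) ∉ conormalSet Ω → y ∈ interior F := by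
    intro y hy hyW
    obtain ⟨r, hr, hball⟩ := h.exists_add_mem_support hΩ hy hyW
    refine mem_interior_iff_mem_nhds.2 (mem_of_superset (Metric.ball_mem_nhds y hr) fun w hw => ?_)
    have hdir : (w : Euc n) - y ∈ P.range := by
      have := AffineSubspace.vsub_mem_direction w.2 y.2
      rwa [show A.direction = P.range from AffineSubspace.direction_mk' _ _] at this
    obtain ⟨u, hu⟩ := hdir
    have hu' : P u = (w : Euc n) - y := hu
    have hPw : P ((w : Euc n) - y) = (w : Euc n) - y := by
      rw [← hu', ← mul_apply_eq_comp, hPG.1.isIdempotentElem.eq]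
    have := hball _ hPw (by rwa [← dist_eq_norm])
    rwa [add_sub_cancel] at this
  have hFI : interior F ⊆ sliceInterior Ω A :=
    interior_mono fun y hy => (hsub hy).1
  have ha₀ : a₀ ∈ interior F := hFopen a₀ hz hzW
  set Δ := connectedComponentIn (sliceInterior Ω A) a₀ with hΔ
  have hΔI : Δ ⊆ sliceInterior Ω A := connectedComponentIn_subset _ _
  have hΔF : Δ ⊆ interior F := by
    refine isPreconnected_connectedComponentIn.subset_of_closure_inter_subset isOpen_interior
      ⟨a₀, mem_connectedComponentIn (hFI ha₀), ha₀⟩ ?_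
    rintro y ⟨hy, hyΔ⟩
    have hyF : y ∈ F := closure_minimal interior_subset hFclosed hy
    exact hFopen y hyF fun hyW => notMem_sliceInterior hΩ y hyW (hΔI hyΔ)
  refine ⟨x₀, P, hPG, Δ, ⟨a₀, hFI ha₀, rfl⟩, fun y hy => ?_⟩
  have hyF : y ∈ F := closure_minimal (hΔF.trans interior_subset) hFclosed hy.1
  refine ((mem_conormalSet_iff_mem_range hPG.1).1 (not_not.1 fun hyW => hy.2 ?_)).2
  have hyI : y ∈ sliceInterior Ω A := hFI (hFopen y hyF hyW)
  have hΔopen : ∀ w, IsOpen (connectedComponentIn (sliceInterior Ω A) w) := fun w =>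
    (isOpen_interior : IsOpen (sliceInterior Ω A)).connectedComponentIn
  rw [(hΔopen a₀).interior_eq]
  -- The point `y` itself belongs to `Δ`: the component of `y` is a
  -- neighbourhood of `y`, hence meets `Δ`.
  obtain ⟨w, hwy, hwΔ⟩ := mem_closure_iff.1 hy.1 _ (hΔopen y) (mem_connectedComponentIn hyI)
  rw [connectedComponentIn_eq hwΔ, ← connectedComponentIn_eq hwy]
  exact mem_connectedComponentIn hyI

/-! ### Mass bounds -/

/-- The mass of the boundary varifold is controlled by the mass and the `L¹` curvature, as one sees
by testing with the gradient of a defining function. -/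
theorem exists_boundary_mass_le (hΩ : IsBoundedC2Domain Ω) (m : ℕ) :
    ∃ C : ℝ, 0 ≤ C ∧ ∀ V B Γ, IsOrthogonalCurvatureVarifold m Ω V B Γ →
      Γ.real Set.univ ≤ C * (V.real Set.univ + ∫ z, hsNorm (B z) ∂V) := by
  obtain ⟨ρ, hρ, hS⟩ := exists_global_definingFunction hΩ
  have hg := contDiff_gradient hρ
  have hφ : ContDiff ℝ 1 fun z : Euc n × Mat n => gradient ρ z.1 := hg.comp contDiff_fst
  have hScpt : IsCompact (frontier Ω) :=
    Metric.isCompact_of_isClosed_isBounded isClosed_frontier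
      (hΩ.isBounded.closure.subset frontier_subset_closure)
  have hinner : ∀ x ∈ frontier Ω, ⟪innerNormal Ω x, gradient ρ x⟫_ℝ = ‖gradient ρ x‖ ∧
      0 < ‖gradient ρ x‖ := fun x hx => by
    obtain ⟨-, c, hc, hgc⟩ := hS x hx
    rw [hgc, real_inner_smul_right, real_inner_self_eq_norm_sq, norm_smul, norm_innerNormal hΩ hx,
      Real.norm_of_nonneg hc.le]
    exact ⟨by ring, by linarith⟩
  obtain ⟨l, hl, hlS⟩ := hScpt.exists_forall_le' (f := fun x => ‖gradient ρ x‖)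
    hg.continuous.norm.continuousOn fun x hx => (hinner x hx).2
  have hK := isCompact_planeBundle (m := m) hΩ.isBounded
  obtain ⟨M₁, hM₁⟩ := hK.exists_bound_of_continuousOn
    (hφ.continuous_fderiv (by norm_num)).continuousOn
  obtain ⟨M₂, hM₂⟩ := hK.exists_bound_of_continuousOn hφ.continuous.continuousOn
  obtain ⟨M₃, hM₃⟩ := hK.exists_bound_of_continuousOn (continuous_derivPointDot hφ).continuousOn
  obtain ⟨M₄, hM₄⟩ := hScpt.exists_bound_of_continuousOn hg.continuous.continuousOn
  set D := max |M₃| ((n * n + n) * |max M₁ M₂|)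
  have hD : 0 ≤ D := (abs_nonneg _).trans (le_max_left _ _)
  refine ⟨D / l, by positivity, fun V B Γ h => ?_⟩
  have := h.finite_V
  have := h.finite_Γ
  have hfirst := h.abs_firstVariation_le hΩ.isBounded hφ (M := |max M₁ M₂|) fun z hz =>
    ⟨(hM₁ z hz).trans ((le_max_left _ _).trans (le_abs_self _)),
      (hM₂ z hz).trans ((le_max_right _ _).trans (le_abs_self _))⟩
  have hbdry : ∫ z, ⟪innerNormal Ω z.1, gradient ρ z.1⟫_ℝ ∂Γ = ∫ z, ‖gradient ρ z.1‖ ∂Γ :=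
    integral_congr_ae (h.ae_mem_frontier.mono fun z hz => (hinner _ hz).1)
  have hlow : l * Γ.real Set.univ ≤ ∫ z, ‖gradient ρ z.1‖ ∂Γ := by
    have hint : Integrable (fun z : Euc n × Mat n => ‖gradient ρ z.1‖) Γ :=
      Integrable.of_bound (hg.continuous.comp continuous_fst).norm.aestronglyMeasurable M₄
        (h.ae_mem_frontier.mono fun z hz => by simpa using hM₄ _ hz)
    have hmono := integral_mono_ae (integrable_const l) hint
      (h.ae_mem_frontier.mono fun z hz => hlS _ hz)
    rwa [integral_const, smul_eq_mul, mul_comm] at hmono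
  have hdiv : |∫ z, derivPointDot (fun z : Euc n × Mat n => gradient ρ z.1) z ∂V| ≤
      |M₃| * V.real Set.univ :=
    norm_integral_le_of_norm_le_const ((ae_mem_of_support h.support_V).mono fun z hz =>
      (hM₃ z hz).trans (le_abs_self _))
  have hB : 0 ≤ ∫ z, hsNorm (B z) ∂V := integral_nonneg fun z => hsNorm_nonneg _
  simp only at hfirst
  rw [hbdry] at hfirst
  have h1 : |M₃| * V.real Set.univ ≤ D * V.real Set.univ :=
    mul_le_mul_of_nonneg_right (le_max_left _ _) measureReal_nonneg
  have h2 : (n * n + n) * |max M₁ M₂| * ∫ z, hsNorm (B z) ∂V ≤ D * ∫ z, hsNorm (B z) ∂V :=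
    mul_le_mul_of_nonneg_right (le_max_right _ _) hB
  rw [div_mul_eq_mul_div, le_div_iff₀ hl, mul_comm, mul_add]
  linarith [(abs_le.1 hfirst).2, (abs_le.1 hdiv).1]

theorem IsOrthogonalCurvatureVarifold.smul (h : IsOrthogonalCurvatureVarifold m Ω V B Γ)
    {c : ℝ≥0∞} (hc : c ≠ ∞) : IsOrthogonalCurvatureVarifold m Ω (c • V) B (c • Γ) where
  finite_V := by
    have := h.finite_V
    exact V.smul_finite hc
  support_V := by rw [Measure.smul_apply, h.support_V, smul_zero]
  integrable_B := h.integrable_B.smul_measure hc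
  finite_Γ := by
    have := h.finite_Γ
    exact Γ.smul_finite hc
  support_Γ := by rw [Measure.smul_apply, h.support_Γ, smul_zero]
  orthogonal φ hφ := by
    rw [integral_smul_measure, integral_smul_measure, h.orthogonal φ hφ, smul_neg]

/-- Scaling `V` and `Γ` to mass one keeps the curvature, and divides the energy by the mass. -/
theorem kappa_le_inv_mass_mul {p : ℝ} (h : IsOrthogonalCurvatureVarifold m Ω V B Γ)
    (hV : mass V ≠ 0) : kappa m p Ω ≤ (mass V)⁻¹ * curvatureEnergy p V B := by
  have := h.finite_V
  refine sInf_le ⟨(mass V)⁻¹ • V, B, (mass V)⁻¹ • Γ, h.smul (ENNReal.inv_ne_top.2 hV), ?_, ?_⟩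
  · rw [mass, Measure.smul_apply, smul_eq_mul]
    exact ENNReal.inv_mul_cancel hV (measure_ne_top V _)
  · rw [curvatureEnergy, curvatureEnergy, lintegral_smul_measure, smul_eq_mul]

theorem mass_le_inv_kappa_mul {p : ℝ} (hκ : 0 < kappa m p Ω)
    (h : IsOrthogonalCurvatureVarifold m Ω V B Γ) (hE : curvatureEnergy p V B ≠ ∞) :
    mass V ≤ (kappa m p Ω)⁻¹ * curvatureEnergy p V B := by
  have := h.finite_V
  by_cases hV : mass V = 0
  · rw [hV]
    exact zero_le
  have hVtop : mass V ≠ ∞ := measure_ne_top V _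
  have h1 : kappa m p Ω ≤ (mass V)⁻¹ * curvatureEnergy p V B := kappa_le_inv_mass_mul h hV
  have hκtop : kappa m p Ω ≠ ∞ :=
    ne_top_of_le_ne_top (ENNReal.mul_ne_top (ENNReal.inv_ne_top.2 hV) hE) h1
  rw [mul_comm, ← div_eq_mul_inv, ENNReal.le_div_iff_mul_le (Or.inl hκ.ne') (Or.inl hκtop)]
  calc mass V * kappa m p Ω ≤ mass V * ((mass V)⁻¹ * curvatureEnergy p V B) := by gcongr
    _ = curvatureEnergy p V B := by
      rw [← mul_assoc, ENNReal.mul_inv_cancel hV hVtop, one_mul]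

theorem ofReal_integral_hsNorm_le {p : ℝ} (hp : 1 ≤ p)
    (h : IsOrthogonalCurvatureVarifold m Ω V B Γ) :
    ENNReal.ofReal (∫ z, hsNorm (B z) ∂V) ≤ mass V + curvatureEnergy p V B := by
  rw [ofReal_integral_eq_lintegral_ofReal h.integrable_hsNorm
    (ae_of_all _ fun z => hsNorm_nonneg _), mass, curvatureEnergy, ← lintegral_one, ← lintegral_add_left measurable_const]
  refine lintegral_mono fun z => ?_
  rcases le_total (hsNorm (B z)) 1 with h1 | h1
  · exact (ENNReal.ofReal_le_one.2 h1).trans le_self_add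
  · exact (ENNReal.ofReal_le_ofReal (Real.self_le_rpow_of_one_le h1 hp)).trans le_add_self

end OrthVarifold

theorem theorem1p4 {n m : ℕ} (hm : 1 ≤ m) (hmn : m < n)
    (Ω : Set (OrthVarifold.Euc n)) (hΩ : OrthVarifold.IsBoundedC2Domain Ω)
    (hslice : ¬ OrthVarifold.HasOrthogonalSlice m Ω) (p : ℝ) (hp : 1 ≤ p) :
    0 < OrthVarifold.kappa m p Ω ∧
    (∀ V B Γ, OrthVarifold.IsOrthogonalCurvatureVarifold m Ω V B Γ →
      OrthVarifold.curvatureEnergy p V B ≠ ∞ →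
      OrthVarifold.mass V ≤
        (OrthVarifold.kappa m p Ω)⁻¹ * OrthVarifold.curvatureEnergy p V B) ∧
    ∃ C : ℝ≥0, ∀ V B Γ, OrthVarifold.IsOrthogonalCurvatureVarifold m Ω V B Γ →
      OrthVarifold.mass Γ ≤ C * OrthVarifold.curvatureEnergy p V B := by
  have hκ : 0 < OrthVarifold.kappa m p Ω := by
    refine pos_iff_ne_zero.2 fun h0 => hslice ?_
    obtain ⟨V, hV⟩ := OrthVarifold.exists_isFlatVarifold_of_kappa_eq_zero hΩ hp h0
    exact hV.hasOrthogonalSlice hΩ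
  refine ⟨hκ, fun V B Γ h hE => OrthVarifold.mass_le_inv_kappa_mul hκ h hE, ?_⟩
  obtain ⟨C, hC, hbound⟩ := OrthVarifold.exists_boundary_mass_le hΩ m
  set κ := OrthVarifold.kappa m p Ω
  have hκinv : κ⁻¹ ≠ ∞ := ENNReal.inv_ne_top.2 hκ.ne'
  have hC'top : ENNReal.ofReal C * (κ⁻¹ + κ⁻¹ + 1) ≠ ∞ := by finiteness
  -- The summand `1` makes the constant positive, for the case of infinite energy.
  refine ⟨(ENNReal.ofReal C * (κ⁻¹ + κ⁻¹ + 1)).toNNReal + 1, fun V B Γ h => ?_⟩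
  rw [ENNReal.coe_add, ENNReal.coe_toNNReal hC'top, ENNReal.coe_one]
  set E := OrthVarifold.curvatureEnergy p V B with hEdef
  by_cases hE : E = ∞
  · rw [hE, ENNReal.mul_top (by simp)]
    exact le_top
  have := h.finite_V
  have := h.finite_Γ
  have hB : 0 ≤ ∫ z, OrthVarifold.hsNorm (B z) ∂V :=
    integral_nonneg fun z => OrthVarifold.hsNorm_nonneg _
  have hmass : OrthVarifold.mass V ≤ κ⁻¹ * E := OrthVarifold.mass_le_inv_kappa_mul hκ h hE
  calc OrthVarifold.mass Γ = ENNReal.ofReal (Γ.real Set.univ) := by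
        rw [ofReal_measureReal, OrthVarifold.mass]
    _ ≤ ENNReal.ofReal (C * (V.real Set.univ + ∫ z, OrthVarifold.hsNorm (B z) ∂V)) :=
        ENNReal.ofReal_le_ofReal (hbound V B Γ h)
    _ = ENNReal.ofReal C *
          (OrthVarifold.mass V + ENNReal.ofReal (∫ z, OrthVarifold.hsNorm (B z) ∂V)) := by
        rw [ENNReal.ofReal_mul hC, ENNReal.ofReal_add measureReal_nonneg hB,
          ofReal_measureReal, OrthVarifold.mass]
    _ ≤ ENNReal.ofReal C * (κ⁻¹ * E + (κ⁻¹ * E + E)) := by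
        gcongr
        exact (OrthVarifold.ofReal_integral_hsNorm_le hp h).trans (by gcongr)
    _ = ENNReal.ofReal C * (κ⁻¹ + κ⁻¹ + 1) * E := by ring
    _ ≤ (ENNReal.ofReal C * (κ⁻¹ + κ⁻¹ + 1) + 1) * E := by
        gcongr
        exact le_self_add
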